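/- **Theorem 5.10.** Let $J$ be a bounded Jacobi operator, i.e. the symmetric tridiagonal matrix, indexed from $0$, with real diagonal entries $\alpha_0,\alpha_1,\dots$ and off-diagonal entries $\beta_0,\beta_1,\dots>0$ (all bounded), and let $\Delta$ be the free Jacobi operator, with diagonal entries $0$ and off-diagonal entries $\tfrac12$. Suppose that $J$ is Toeplitz-plus-trace-class, that is, $\sum_{k\ge0}\left(|\beta_k-\tfrac12|+|\alpha_k|\right)<\infty$. For $m\ge0$ let $J^{[m]}$ be the Jacobi operator with $J^{[m]}_{i,j}=J_{i,j}$ if $i,j<m$ and $J^{[m]}_{i,j}=\Delta_{i,j}$ otherwise. For a Jacobi operator $J$, let $P_k$ be its orthonormal polynomials, $P_0=1$, $sP_k=\beta_{k-1}P_{k-1}+\alpha_kP_k+\beta_kP_{k+1}$ for $k\ge0$ (with $P_{-1}=0$), and $P^\mu_k$ its first associated polynomials, $P_0^\mu=0$, $P_1^\mu=\beta_0^{-1}$, $sP^\mu_k=\beta_{k-1}P^\mu_{k-1}+\alpha_kP^\mu_k+\beta_kP^\mu_{k+1}$ for $k\ge1$. Let $U_k$ be the orthonormal polynomials of $\Delta$.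 The connection coefficient matrices $C=C_{J\to\Delta}=(c_{ij})$ and $C^\mu=C^\mu_{J\to\Delta}=(c^\mu_{ij})$ are the upper triangular matrices with $P_k=\sum_{i=0}^k c_{ik}U_i$ and $P^\mu_k=\sum_{i=0}^k c^\mu_{ik}U_i$. For $r>0$ let $\ell^1_r$ be the Banach space of complex sequences with norm $\|v\|=\sum_k|v_k|r^k$. We say that an upper triangular matrix $A$ has Toeplitz part $A_{\rm Toe}$, with entries $t_{j-i}$ for $i\le j$ and $0$ for $i>j$, if $t_k=\lim_{i\to\infty}A_{i,i+k}$ for every $k\ge0$ and, for every $R\in(0,1)$, $A_{\rm Toe}$ is bounded and $A-A_{\rm Toe}$ is compact as an operator from $\ell^1_{R^{-1}}$ to itself. Its Toeplitz symbol is $z\mapsto\sum_{k\ge0}t_kz^k$. Then the matrices $C$ and $C^\mu$ of $J$ and of every $J^{[m]}$ have Toeplitz parts. The series of their Toeplitz symbols, denoted $c$, $c_\mu$ (for $J$) and $c^{[m]}$, $c^{[m]}_\mu$ (for $J^{[m]}$), converge absolutely in the open unit disc $\mathbb D$. The functions $c$ and $c_\mu$ are analytic in $\mathbb D$, and $c^{[m]}\to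 c$ and $c^{[m]}_\mu\to c_\mu$ as $m\to\infty$, uniformly on compact subsets of $\mathbb D$. -/

import Mathlib

open Filter Topology Polynomial

noncomputable section

/-! ### Bounded Jacobi operators -/

/-- A bounded Jacobi operator, given by its diagonal entries `α k` and its off-diagonal entries
`β k > 0`, both bounded. -/
structure JacobiOperator where
  /-- diagonal entries -/
  α : ℕ → ℝ
  /-- off-diagonal entries -/
  β : ℕ → ℝ
  β_pos : ∀ k, 0 < β k
  bounded : ∃ M : ℝ, ∀ k, |α k| ≤ M ∧ |β k| ≤ M

namespace JacobiOperator

/-- The symmetric tridiagonal matrix of a Jacobi operator in the standard basis. -/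
def toMatrix (J : JacobiOperator) : Matrix ℕ ℕ ℝ := fun i j =>
  if i = j then J.α i
  else if j = i + 1 then J.β i
  else if i = j + 1 then J.β j
  else 0

/-- The free Jacobi operator `Δ`: zero diagonal, off-diagonal entries `1/2`. -/
def free : JacobiOperator where
  α := fun _ => 0
  β := fun _ => 1 / 2
  β_pos := fun _ => by norm_num
  bounded := ⟨1, fun _ => by norm_num [abs_of_pos]⟩

/-- `J = Δ + K` with `K` trace class: `∑ (|β_k - 1/2| + |α_k|) < ∞`. -/
def IsToeplitzPlusTraceClass (J : JacobiOperator) : Prop :=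
  Summable fun k => |J.β k - 1 / 2| + |J.α k|

/-- The Toeplitz-plus-finite-rank truncation `J^[m]`: the entries with both indices `< m` are those
of `J`, all others are those of `Δ`; see `truncation_toMatrix`. -/
def truncation (J : JacobiOperator) (m : ℕ) : JacobiOperator where
  α := fun k => if k < m then J.α k else 0
  β := fun k => if k + 1 < m then J.β k else 1 / 2
  β_pos := fun k => by
    have := J.β_pos k
    split_ifs <;> [exact this; norm_num]
  bounded := by
    obtain ⟨M, hM⟩ := J.bounded
    refine ⟨max M 1, fun k => ⟨?_, ?_⟩⟩
    · split_ifs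
      · exact (hM k).1.trans (le_max_left _ _)
      · simp
    · split_ifs
      · exact (hM k).2.trans (le_max_left _ _)
      · refine le_trans ?_ (le_max_right _ _)
        norm_num [abs_of_pos]

theorem truncation_toMatrix (J : JacobiOperator) (m i j : ℕ) :
    (J.truncation m).toMatrix i j =
      if i < m ∧ j < m then J.toMatrix i j else free.toMatrix i j := by
  simp only [toMatrix, truncation, free]
  grind

/-! ### Orthonormal and first associated polynomials -/

/-- The orthonormal polynomials `P_k` of `J`: `P_0 = 1` and
`s P_k = β_{k-1} P_{k-1} + α_k P_k + β_k P_{k+1}` with `P_{-1} = 0`. -/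
def orthoPoly (J : JacobiOperator) : ℕ → ℝ[X]
  | 0 => 1
  | 1 => C (J.β 0)⁻¹ * (X - C (J.α 0))
  | k + 2 => C (J.β (k + 1))⁻¹ *
      ((X - C (J.α (k + 1))) * orthoPoly J (k + 1) - C (J.β k) * orthoPoly J k)

/-- The first associated polynomials `P^μ_k` of `J`: `P^μ_0 = 0`, `P^μ_1 = β_0⁻¹` and
`s P^μ_k = β_{k-1} P^μ_{k-1} + α_k P^μ_k + β_k P^μ_{k+1}` for `k ≥ 1`. -/
def assocPoly (J : JacobiOperator) : ℕ → ℝ[X]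
  | 0 => 0
  | 1 => C (J.β 0)⁻¹
  | k + 2 => C (J.β (k + 1))⁻¹ *
      ((X - C (J.α (k + 1))) * assocPoly J (k + 1) - C (J.β k) * assocPoly J k)

theorem C_mul_C_inv (J : JacobiOperator) (k : ℕ) :
    C (J.β k) * C (J.β k)⁻¹ = (1 : ℝ[X]) := by
  rw [← C_mul, mul_inv_cancel₀ (J.β_pos k).ne', C_1]

theorem X_mul_orthoPoly_zero (J : JacobiOperator) :
    X * J.orthoPoly 0 = C (J.α 0) * J.orthoPoly 0 + C (J.β 0) * J.orthoPoly 1 := by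
  simp only [orthoPoly]
  linear_combination (-(X - C (J.α 0))) * J.C_mul_C_inv 0

theorem X_mul_orthoPoly_succ (J : JacobiOperator) (k : ℕ) :
    X * J.orthoPoly (k + 1) = C (J.β k) * J.orthoPoly k + C (J.α (k + 1)) * J.orthoPoly (k + 1)
      + C (J.β (k + 1)) * J.orthoPoly (k + 2) := by
  simp only [orthoPoly]
  linear_combination (-((X - C (J.α (k + 1))) * J.orthoPoly (k + 1)
    - C (J.β k) * J.orthoPoly k)) * J.C_mul_C_inv (k + 1)

theorem X_mul_assocPoly_succ (J : JacobiOperator) (k : ℕ) :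
    X * J.assocPoly (k + 1) = C (J.β k) * J.assocPoly k + C (J.α (k + 1)) * J.assocPoly (k + 1)
      + C (J.β (k + 1)) * J.assocPoly (k + 2) := by
  simp only [assocPoly]
  linear_combination (-((X - C (J.α (k + 1))) * J.assocPoly (k + 1)
    - C (J.β k) * J.assocPoly k)) * J.C_mul_C_inv (k + 1)

theorem degree_orthoPoly (J : JacobiOperator) : ∀ k : ℕ, (J.orthoPoly k).degree = k
  | 0 => by simp [orthoPoly]
  | 1 => by
      have h : (J.β 0)⁻¹ ≠ 0 := inv_ne_zero (J.β_pos 0).ne'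
      rw [orthoPoly, degree_C_mul h, degree_X_sub_C]; rfl
  | k + 2 => by
      have h : (J.β (k + 1))⁻¹ ≠ 0 := inv_ne_zero (J.β_pos (k + 1)).ne'
      have h1 := degree_orthoPoly J (k + 1)
      have h0 := degree_orthoPoly J k
      have h2 : ((X - C (J.α (k + 1))) * J.orthoPoly (k + 1)).degree = ((k + 2 : ℕ) : WithBot ℕ) := by
        rw [degree_mul, degree_X_sub_C, h1]; norm_cast; omega
      rw [orthoPoly, degree_C_mul h, degree_sub_eq_left_of_degree_lt, h2]
      rw [h2, degree_C_mul (J.β_pos k).ne', h0]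
      norm_cast; omega

theorem degree_assocPoly_lt (J : JacobiOperator) :
    ∀ k : ℕ, (J.assocPoly k).degree < ((k + 1 : ℕ) : WithBot ℕ)
  | 0 => by simp [assocPoly]
  | 1 => by
      rw [assocPoly]
      exact degree_C_le.trans_lt (by norm_num)
  | k + 2 => by
      have h1 := degree_assocPoly_lt J (k + 1)
      have h0 := degree_assocPoly_lt J k
      rw [← mem_degreeLT] at h1 h0 ⊢
      have h0' : J.assocPoly k ∈ degreeLT ℝ (k + 2 + 1) := degreeLT_mono (by omega) h0
      have h1' : J.assocPoly (k + 1) ∈ degreeLT ℝ (k + 2 + 1) := degreeLT_mono (by omega) h1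
      have h2 : X * J.assocPoly (k + 1) ∈ degreeLT ℝ (k + 2 + 1) := by
        rw [mem_degreeLT] at h1 ⊢
        by_cases hz : J.assocPoly (k + 1) = 0
        · simp only [hz, mul_zero, degree_zero]; exact WithBot.bot_lt_coe _
        · rw [degree_mul, degree_X, degree_eq_natDegree hz]
          rw [degree_eq_natDegree hz] at h1
          norm_cast at h1 ⊢; omega
      rw [assocPoly, sub_mul, ← smul_eq_C_mul, ← smul_eq_C_mul, ← smul_eq_C_mul]
      exact Submodule.smul_mem _ _ (Submodule.sub_mem _ (Submodule.sub_mem _ h2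
        (Submodule.smul_mem _ _ h1')) (Submodule.smul_mem _ _ h0'))

/-- The orthonormal polynomials as a polynomial sequence (the `k`-th one has degree `k`). -/
def orthoSeq (J : JacobiOperator) : Polynomial.Sequence ℝ where
  elems' := J.orthoPoly
  degree_eq' := J.degree_orthoPoly

theorem orthoSeq_leadingCoeff (J : JacobiOperator) (k : ℕ) :
    IsUnit (J.orthoSeq k).leadingCoeff :=
  isUnit_iff_ne_zero.mpr (leadingCoeff_ne_zero.mpr (J.orthoSeq.ne_zero k))

/-- The orthonormal polynomials as a basis of `ℝ[X]`. -/
def orthoBasis (J : JacobiOperator) : Module.Basis ℕ ℝ ℝ[X] :=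
  J.orthoSeq.basis J.orthoSeq_leadingCoeff

theorem orthoBasis_apply (J : JacobiOperator) (k : ℕ) : J.orthoBasis k = J.orthoPoly k :=
  J.orthoSeq.basis_eq_self J.orthoSeq_leadingCoeff k

/-! ### Connection coefficient matrices -/

/-- The matrix `(c_{ij})` of the change of basis from a family `p` of polynomials to the orthonormal
polynomials `Q_i` of `D`, that is `p_j = ∑_i c_{ij} Q_i`. -/
def changeMatrix (p : ℕ → ℝ[X]) (D : JacobiOperator) : Matrix ℕ ℕ ℝ :=
  fun i j => D.orthoBasis.repr (p j) i

/-- The connection coefficient matrix `C_{J → D}`. -/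
def connection (J D : JacobiOperator) : Matrix ℕ ℕ ℝ := changeMatrix J.orthoPoly D

/-- The matrix `C^μ_{J → D}`: connection coefficients between the first associated polynomials of
`J` and the orthonormal polynomials of `D`. -/
def connectionMu (J D : JacobiOperator) : Matrix ℕ ℕ ℝ := changeMatrix J.assocPoly D

theorem changeMatrix_eq_zero (p : ℕ → ℝ[X]) (D : JacobiOperator)
    (hp : ∀ k : ℕ, (p k).degree < ((k + 1 : ℕ) : WithBot ℕ)) {i j : ℕ} (h : j < i) :
    changeMatrix p D i j = 0 := by
  have h1 : p j ∈ Submodule.span ℝ (D.orthoBasis '' Set.Iio (j + 1)) := by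
    have h2 := D.orthoSeq.span_degreeLT (m := j + 1) (fun k _ => D.orthoSeq_leadingCoeff k)
    have h3 : (D.orthoBasis : ℕ → ℝ[X]) = D.orthoSeq :=
      funext D.orthoBasis_apply
    rw [h3, h2, mem_degreeLT]
    exact hp j
  have h4 := (D.orthoBasis.mem_span_image).mp h1
  by_contra h5
  have h6 : i ∈ ((D.orthoBasis.repr (p j)).support : Set ℕ) := by
    simpa [changeMatrix] using h5
  have h7 := h4 h6
  simp only [Set.mem_Iio] at h7
  omega

theorem changeMatrix_sum (p : ℕ → ℝ[X]) (D : JacobiOperator)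
    (hp : ∀ k : ℕ, (p k).degree < ((k + 1 : ℕ) : WithBot ℕ)) (k : ℕ) :
    p k = ∑ i ∈ Finset.range (k + 1), C (changeMatrix p D i k) * D.orthoPoly i := by
  conv_lhs => rw [← D.orthoBasis.linearCombination_repr (p k)]
  rw [Finsupp.linearCombination_apply, Finsupp.sum_of_support_subset (s := Finset.range (k + 1))]
  · refine Finset.sum_congr rfl fun i _ => ?_
    rw [orthoBasis_apply, smul_eq_C_mul]; rfl
  · intro i hi
    by_contra h
    rw [Finset.mem_range, not_lt] at h
    exact (Finsupp.mem_support_iff.mp hi) (changeMatrix_eq_zero p D hp (by omega))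
  · simp

theorem connection_eq_zero (J D : JacobiOperator) {i j : ℕ} (h : j < i) :
    J.connection D i j = 0 :=
  changeMatrix_eq_zero _ _ (fun k => by rw [degree_orthoPoly]; norm_cast; omega) h

/-- `P_k = c_{0k} Q_0 + ⋯ + c_{kk} Q_k`. -/
theorem orthoPoly_eq_sum (J D : JacobiOperator) (k : ℕ) :
    J.orthoPoly k = ∑ i ∈ Finset.range (k + 1), C (J.connection D i k) * D.orthoPoly i :=
  changeMatrix_sum _ _ (fun k => by rw [degree_orthoPoly]; norm_cast; omega) k

theorem connectionMu_eq_zero (J D : JacobiOperator) {i j : ℕ} (h : j < i) :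
    J.connectionMu D i j = 0 :=
  changeMatrix_eq_zero _ _ J.degree_assocPoly_lt h

theorem assocPoly_eq_sum (J D : JacobiOperator) (k : ℕ) :
    J.assocPoly k = ∑ i ∈ Finset.range (k + 1), C (J.connectionMu D i k) * D.orthoPoly i :=
  changeMatrix_sum _ _ J.degree_assocPoly_lt k

end JacobiOperator

/-! ### Geometrically weighted `ℓ¹` spaces -/

/-- The sequences `v` with `∑ |v_k| r^k < ∞`, as a subspace of the space of all sequences. -/
def geomL1Submodule (r : Set.Ioi (0 : ℝ)) : Submodule ℂ (ℕ → ℂ) where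
  carrier := {v | Summable fun k => ‖v k‖ * (r : ℝ) ^ k}
  zero_mem' := by simp
  add_mem' := by
    intro v w hv hw
    refine Summable.of_nonneg_of_le
      (fun k => mul_nonneg (norm_nonneg _) (pow_nonneg (le_of_lt r.2) k)) (fun k => ?_) (hv.add hw)
    rw [← add_mul]
    exact mul_le_mul_of_nonneg_right (norm_add_le _ _) (pow_nonneg (le_of_lt r.2) k)
  smul_mem' := by
    intro a v hv
    have h : (fun k => ‖(a • v) k‖ * (r : ℝ) ^ k) = fun k => ‖a‖ * (‖v k‖ * (r : ℝ) ^ k) := by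
      funext k
      simp [mul_assoc]
    change Summable _
    rw [h]
    exact Summable.mul_left _ hv

/-- The Banach space `ℓ¹_r` of complex sequences with norm `‖v‖ = ∑ |v_k| r^k`. It is a type of its
own, so that it does not carry the topology of pointwise convergence. -/
def GeomL1 (r : Set.Ioi (0 : ℝ)) : Type := geomL1Submodule r

namespace GeomL1

variable {r : Set.Ioi (0 : ℝ)}

instance : AddCommGroup (GeomL1 r) := inferInstanceAs (AddCommGroup (geomL1Submodule r))

instance : Module ℂ (GeomL1 r) := inferInstanceAs (Module ℂ (geomL1Submodule r))

/-- The `k`-th term of a sequence in `ℓ¹_r`. -/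
def coord (v : GeomL1 r) (k : ℕ) : ℂ := Subtype.val (p := fun x => x ∈ geomL1Submodule r) v k

theorem summable (v : GeomL1 r) : Summable fun k => ‖v.coord k‖ * (r : ℝ) ^ k :=
  Subtype.property (p := fun x => x ∈ geomL1Submodule r) v

instance : Norm (GeomL1 r) := ⟨fun v => ∑' k, ‖v.coord k‖ * (r : ℝ) ^ k⟩

theorem norm_def (v : GeomL1 r) : ‖v‖ = ∑' k, ‖v.coord k‖ * (r : ℝ) ^ k := rfl

@[simp] theorem coord_add (v w : GeomL1 r) (k : ℕ) : (v + w).coord k = v.coord k + w.coord k := rfl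

@[simp] theorem coord_smul (a : ℂ) (v : GeomL1 r) (k : ℕ) : (a • v).coord k = a * v.coord k := rfl

@[simp] theorem coord_zero (k : ℕ) : (0 : GeomL1 r).coord k = 0 := rfl

theorem ext_coord {v w : GeomL1 r} (h : ∀ k, v.coord k = w.coord k) : v = w :=
  Subtype.ext (p := fun x => x ∈ geomL1Submodule r) (funext h)

theorem normCore : NormedSpace.Core ℂ (GeomL1 r) where
  norm_nonneg v := tsum_nonneg fun k => mul_nonneg (norm_nonneg _) (pow_nonneg (le_of_lt r.2) k)
  norm_smul a v := by
    simp only [norm_def, coord_smul, norm_mul, mul_assoc, tsum_mul_left]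
  norm_triangle v w := by
    rw [norm_def, norm_def, norm_def, ← v.summable.tsum_add w.summable]
    refine (v + w).summable.tsum_le_tsum (fun k => ?_) (v.summable.add w.summable)
    rw [← add_mul]
    exact mul_le_mul_of_nonneg_right (norm_add_le _ _) (pow_nonneg (le_of_lt r.2) k)
  norm_eq_zero_iff v := by
    constructor
    · intro h
      have h0 := v.summable.hasSum
      rw [← norm_def, h, hasSum_zero_iff_of_nonneg
        (fun k => mul_nonneg (norm_nonneg _) (pow_nonneg (le_of_lt r.2) k))] at h0
      refine ext_coord fun k => ?_
      have h1 := congrFun h0 k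
      simp only [Pi.zero_apply, mul_eq_zero, norm_eq_zero] at h1
      exact h1.resolve_right (pow_ne_zero k (ne_of_gt r.2))
    · rintro rfl
      simp [norm_def]

instance : NormedAddCommGroup (GeomL1 r) := NormedAddCommGroup.ofCore normCore

instance : NormedSpace ℂ (GeomL1 r) := NormedSpace.ofCore normCore

end GeomL1

/-! ### Toeplitz parts and Toeplitz symbols -/

/-- The operator `L` on `ℓ¹_r` is given by the infinite matrix `A`. -/
def IsMatrixOperator {r : Set.Ioi (0 : ℝ)} (A : Matrix ℕ ℕ ℝ) (L : GeomL1 r →L[ℂ] GeomL1 r) :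
    Prop :=
  ∀ (v : GeomL1 r) (i : ℕ), HasSum (fun j => (A i j : ℂ) * v.coord j) ((L v).coord i)

/-- `A` defines a bounded operator from `ℓ¹_r` into itself. -/
def IsBoundedOn (r : Set.Ioi (0 : ℝ)) (A : Matrix ℕ ℕ ℝ) : Prop :=
  ∃ L : GeomL1 r →L[ℂ] GeomL1 r, IsMatrixOperator A L

/-- `A` defines a compact operator from `ℓ¹_r` into itself. -/
def IsCompactOn (r : Set.Ioi (0 : ℝ)) (A : Matrix ℕ ℕ ℝ) : Prop :=
  ∃ L : GeomL1 r →L[ℂ] GeomL1 r, IsMatrixOperator A L ∧ IsCompactOperator L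

/-- The upper triangular Toeplitz matrix with entry `t_{j-i}` at `(i, j)` for `i ≤ j`. -/
def upperToeplitz (t : ℕ → ℝ) : Matrix ℕ ℕ ℝ := fun i j => if i ≤ j then t (j - i) else 0

/-- The upper triangular Toeplitz matrix with entries `t_{j-i}` is the Toeplitz part of `A`: the
numbers `t_k` are the limits of the diagonals of `A` (so that `A` determines them), and in
`A = upperToeplitz t + (A - upperToeplitz t)` the first summand is bounded and the second one
compact on `ℓ¹_{R⁻¹}`, for all `R ∈ (0, 1)`. -/
def IsToeplitzPart (A : Matrix ℕ ℕ ℝ) (t : ℕ → ℝ) : Prop :=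
  (∀ k, Tendsto (fun i => A i (i + k)) atTop (𝓝 (t k))) ∧
  ∀ (R : ℝ) (hR : 0 < R), R < 1 →
    IsBoundedOn ⟨R⁻¹, inv_pos.mpr hR⟩ (upperToeplitz t) ∧
    IsCompactOn ⟨R⁻¹, inv_pos.mpr hR⟩ (A - upperToeplitz t)

/-- The Toeplitz symbol `z ↦ ∑ t_k z^k` of the Toeplitz matrix with entries `t_{j-i}`. -/
def toeplitzSymbol (t : ℕ → ℝ) (z : ℂ) : ℂ := ∑' k, (t k : ℂ) * z ^ k

/-- The series of the Toeplitz symbol converges absolutely in the open unit disc. -/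
def SymbolConverges (t : ℕ → ℝ) : Prop :=
  ∀ z ∈ Metric.ball (0 : ℂ) 1, Summable fun k => ‖(t k : ℂ) * z ^ k‖

end

/-! Since multiplication by `X` is `Δ` in the basis `U_i`, the three term recurrence says that `ΔC =
CJ` in every column but the first; the same holds for `C^μ`. Read along diagonals and scaled by `w_n
= ∏_{j<n} 2β_j`, the entries `f n k = w_n c_{n-k,n}` satisfy `f (n+2) (k+2) - f (n+1) (k+2) = (f
(n+1) k - f n k) + (1 - 4β_n²) f n k - 2α_{n+1} f (n+1) (k+1)`. For `J = Δ` the increments along the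
diagonals are merely shifted by two; in general there is an error of size `e_n = |1 - 4β_n²| +
2|α_{n+1}|` times earlier entries, and `∑ e_n < ∞`.

With weights `R^k`, `R < 1`, the shift is a contraction by `R²`, and a discrete Gronwall argument
bounds `|f n k| R^k` uniformly in `n` and `k` (`growth`, `exists_bound`). Increments on a fixed
diagonal are then summable, so the diagonals converge; `w_n` has a positive limit, so those of `C`
converge too. The norm of an operator on `ℓ¹_{R⁻¹}` is governed by its columns, and the columns of
`C - C_Toe`, relative to `R^{-j}`, tend to zero by dominated convergence: this gives compactness
(`isToeplitzPart_of_dominated`).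

All bounds depend on `J` only through `e_n`, `|α_0|` and a lower bound for `w_n`. Truncating does
not increase the first two and preserves the third, so the bounds are uniform in `m`. Each entry of
`J^[m]`'s array is eventually that of `J`, and dominated convergence gives convergence of the
Toeplitz coefficients (`tendsto_limit`) and then of the symbols. -/

noncomputable section

/-! ### Sequences obeying a summably perturbed recurrence -/

/-- The increments `f (n + 1) k - f n k` are those of the previous step, shifted by two in `k`, up
to an error controlled by `e n`; the initial data are bounded by `A`. -/
structure IsPerturbedShift (e : ℕ → ℝ) (A : ℝ) (f : ℕ → ℕ → ℝ) : Prop where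
  init_zero : ∀ k, |f 0 k| ≤ A
  init_one : ∀ k, |f 1 k| ≤ A
  step_zero : ∀ n, f (n + 2) 0 = f (n + 1) 0
  step_one : ∀ n, |f (n + 2) 1 - f (n + 1) 1| ≤ e n * |f (n + 1) 0|
  step : ∀ n k, |f (n + 2) (k + 2) - f (n + 1) (k + 2)| ≤
    |f (n + 1) k - f n k| + e n * (|f n k| + |f (n + 1) (k + 1)|)

namespace IsPerturbedShift

variable {e : ℕ → ℝ} {A : ℝ}

theorem mono {e' : ℕ → ℝ} {f : ℕ → ℕ → ℝ} (h : IsPerturbedShift e A f) (he : ∀ n, e n ≤ e' n) :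
    IsPerturbedShift e' A f where
  init_zero := h.init_zero
  init_one := h.init_one
  step_zero := h.step_zero
  step_one n := (h.step_one n).trans (mul_le_mul_of_nonneg_right (he n) (abs_nonneg _))
  step n k := (h.step n k).trans
    (add_le_add_right (mul_le_mul_of_nonneg_right (he n) (by positivity)) _)

/-- Here `x` dominates two consecutive rows and `y` their difference, with weights `R ^ k`. The
shift by two damps old increments by `R ^ 2`, so the new bounds are `y' = R² y + 2 e_n x` and `x' =
x + y'`. The combination `(1 - R²) x + R² y` is exactly conserved when `e_n = 0`, hence in general
grows at most by the factor `1 + 2 e_n / (1 - R²)`. -/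
theorem growth (he0 : ∀ n, 0 ≤ e n) (hA : 0 ≤ A) {R : ℝ} (hR0 : 0 < R) (hR1 : R < 1)
    {f : ℕ → ℕ → ℝ} (hf : IsPerturbedShift e A f) (n : ℕ) :
    ∃ x y : ℝ, 0 ≤ x ∧ 0 ≤ y ∧ (∀ k, |f n k| * R ^ k ≤ x) ∧ (∀ k, |f (n + 1) k| * R ^ k ≤ x) ∧
      (∀ k, |f (n + 1) k - f n k| * R ^ k ≤ y) ∧
      (1 - R ^ 2) * x + R ^ 2 * y ≤
        2 * A * Real.exp (∑ j ∈ Finset.range n, 2 / (1 - R ^ 2) * e j) := by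
  have hq : 0 < 1 - R ^ 2 := by nlinarith
  induction n with
  | zero =>
    have hp : ∀ (a : ℝ) (k : ℕ), |a| * R ^ k ≤ |a| := fun a k =>
      mul_le_of_le_one_right (abs_nonneg _) (pow_le_one₀ hR0.le hR1.le)
    refine ⟨A, 2 * A, hA, by positivity, fun k => (hp _ k).trans (hf.init_zero k),
      fun k => (hp _ k).trans (hf.init_one k), fun k => (hp _ k).trans ?_, ?_⟩
    · have := abs_sub (f (0 + 1) k) (f 0 k)
      have h0 := hf.init_zero k
      have h1 := hf.init_one k
      simp only [zero_add] at this ⊢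
      linarith
    · simp only [Finset.range_zero, Finset.sum_empty, Real.exp_zero]
      nlinarith
  | succ n ih =>
    obtain ⟨x, y, hx, hy, h0, h1, hd, hE⟩ := ih
    have hex : 0 ≤ e n * x := mul_nonneg (he0 n) hx
    have hd' : ∀ k, |f (n + 2) k - f (n + 1) k| * R ^ k ≤ R ^ 2 * y + 2 * (e n * x) := by
      intro k
      match k with
      | 0 => rw [hf.step_zero]; simp; positivity
      | 1 =>
        have h2 := mul_le_mul_of_nonneg_right (hf.step_one n) (pow_nonneg hR0.le 1)
        have h3 := mul_le_mul_of_nonneg_left (h1 0) (he0 n)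
        have h4 : e n * |f (n + 1) 0| * R ^ 1 ≤ e n * |f (n + 1) 0| :=
          mul_le_of_le_one_right (mul_nonneg (he0 n) (abs_nonneg _)) (by simpa using hR1.le)
        simp only [pow_zero, mul_one] at h3
        nlinarith [mul_nonneg (sq_nonneg R) hy]
      | k + 2 =>
        have h2 := mul_le_mul_of_nonneg_right (hf.step n k) (pow_nonneg hR0.le (k + 2))
        have h3 := mul_le_mul_of_nonneg_left (hd k) (sq_nonneg R)
        have h4 : R ^ 2 * (|f n k| * R ^ k) ≤ x :=
          (mul_le_of_le_one_left (by positivity) (by nlinarith)).trans (h0 k)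
        have h5 : R * (|f (n + 1) (k + 1)| * R ^ (k + 1)) ≤ x :=
          (mul_le_of_le_one_left (by positivity) hR1.le).trans (h1 (k + 1))
        have h6 := mul_le_mul_of_nonneg_left (add_le_add h4 h5) (he0 n)
        refine h2.trans ?_
        calc _ = R ^ 2 * (|f (n + 1) k - f n k| * R ^ k) + e n * (R ^ 2 * (|f n k| * R ^ k) +
              R * (|f (n + 1) (k + 1)| * R ^ (k + 1))) := by ring
          _ ≤ _ := by linarith
    have hy' : 0 ≤ R ^ 2 * y + 2 * (e n * x) := by positivity
    refine ⟨x + (R ^ 2 * y + 2 * (e n * x)), _, by positivity, hy',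
      fun k => (h1 k).trans (by linarith), fun k => ?_, hd', ?_⟩
    · have h2 : |f (n + 2) k| ≤ |f (n + 1) k| + |f (n + 2) k - f (n + 1) k| := by
        have := abs_add_le (f (n + 1) k) (f (n + 2) k - f (n + 1) k)
        simpa using this
      have := mul_le_mul_of_nonneg_right h2 (pow_nonneg hR0.le k)
      have h3 := h1 k
      have h4 := hd' k
      change |f (n + 2) k| * R ^ k ≤ _
      linarith
    · rw [Finset.sum_range_succ, Real.exp_add, ← mul_assoc (2 * A)]
      have h2 : 1 + 2 / (1 - R ^ 2) * e n ≤ Real.exp (2 / (1 - R ^ 2) * e n) := by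
        rw [add_comm]; exact Real.add_one_le_exp _
      have h3 : 0 ≤ (1 - R ^ 2) * x + R ^ 2 * y := by positivity
      have h4 : 0 ≤ 1 + 2 / (1 - R ^ 2) * e n := by
        have := he0 n
        positivity
      refine le_trans ?_ (mul_le_mul hE h2 h4 (h3.trans hE))
      have h5 : ((1 - R ^ 2) * x + R ^ 2 * y) * (1 + 2 / (1 - R ^ 2) * e n) =
          (1 - R ^ 2) * x + R ^ 2 * y + 2 * (e n * x) + 2 / (1 - R ^ 2) * (e n * (R ^ 2 * y)) := by
        field_simp
        ring
      have h6 : 0 ≤ 2 / (1 - R ^ 2) * (e n * (R ^ 2 * y)) := by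
        have := he0 n
        positivity
      rw [h5]
      linarith

/-- The order of quantifiers matters: `B` does not depend on `f`, so one constant will serve `J` and
all its truncations. -/
theorem exists_bound (he0 : ∀ n, 0 ≤ e n) (he : Summable e) (hA : 0 ≤ A) {R : ℝ} (hR0 : 0 < R)
    (hR1 : R < 1) :
    ∃ B : ℝ, 0 ≤ B ∧ ∀ f, IsPerturbedShift e A f → ∀ n k, |f n k| * R ^ k ≤ B := by
  have hq : 0 < 1 - R ^ 2 := by nlinarith
  refine ⟨2 * A * Real.exp (2 / (1 - R ^ 2) * ∑' j, e j) / (1 - R ^ 2), by positivity,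
    fun f hf n k => ?_⟩
  obtain ⟨x, y, hx, hy, h0, -, -, hE⟩ := hf.growth he0 hA hR0 hR1 n
  refine (h0 k).trans ?_
  rw [le_div_iff₀ hq]
  have h1 : ∑ j ∈ Finset.range n, 2 / (1 - R ^ 2) * e j ≤ 2 / (1 - R ^ 2) * ∑' j, e j := by
    rw [← Finset.mul_sum]
    exact mul_le_mul_of_nonneg_left (he.sum_le_tsum _ fun j _ => he0 j) (by positivity)
  have h2 := mul_le_mul_of_nonneg_left (Real.exp_le_exp.mpr h1) (by positivity : 0 ≤ 2 * A)
  nlinarith [mul_nonneg (sq_nonneg R) hy]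

/-- All arrays obeying the same perturbed recurrence are dominated, in each geometrically weighted
`ℓ¹` norm, by one summable sequence. -/
theorem exists_summable_bound (he0 : ∀ n, 0 ≤ e n) (he : Summable e) (hA : 0 ≤ A) {R : ℝ}
    (hR0 : 0 < R) (hR1 : R < 1) :
    ∃ g : ℕ → ℝ, Summable g ∧ ∀ f, IsPerturbedShift e A f → ∀ n k, |f n k| * R ^ k ≤ g k := by
  -- A bound at a larger radius `S < 1` yields geometric decay with ratio `R / S` at radius `R`.
  obtain ⟨S, hRS, hS1⟩ := exists_between hR1
  have hS0 := hR0.trans hRS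
  obtain ⟨B, -, hB⟩ := exists_bound he0 he hA hS0 hS1
  refine ⟨fun k => B * (R / S) ^ k, (summable_geometric_of_lt_one (by positivity)
    ((div_lt_one hS0).mpr hRS)).mul_left B, fun f hf n k => ?_⟩
  have := mul_le_mul_of_nonneg_right (hB f hf n k) (by positivity : 0 ≤ (R / S) ^ k)
  calc _ = |f n k| * S ^ k * (R / S) ^ k := by rw [div_pow]; field_simp
    _ ≤ _ := this

/-- The recurrence bounds the increments on diagonal `k + 2` by those on diagonal `k` plus `e n`
times bounded entries, whence an induction in steps of two. That `g` does not depend on `f` allows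
dominated convergence across a family of arrays. -/
theorem exists_increment_bound (he0 : ∀ n, 0 ≤ e n) (he : Summable e) (hA : 0 ≤ A) (k : ℕ) :
    ∃ g : ℕ → ℝ, Summable g ∧
      ∀ f, IsPerturbedShift e A f → ∀ n, |f (n + 1) k - f n k| ≤ g n := by
  obtain ⟨B, hB0, hB⟩ := exists_bound he0 he hA (R := 1 / 2) (by norm_num) (by norm_num)
  have hB' : ∀ f, IsPerturbedShift e A f → ∀ n k, |f n k| ≤ B * 2 ^ k := fun f hf n k => by
    have := mul_le_mul_of_nonneg_right (hB f hf n k) (by positivity : (0 : ℝ) ≤ 2 ^ k)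
    rwa [mul_assoc, ← mul_pow, one_div_mul_cancel two_ne_zero, one_pow, mul_one] at this
  have h0 : ∀ f, IsPerturbedShift e A f → ∀ k, |f 1 k - f 0 k| ≤ 2 * A := fun f hf k => by
    have := abs_sub (f 1 k) (f 0 k)
    linarith [hf.init_zero k, hf.init_one k]
  have extend : ∀ (k : ℕ) (g : ℕ → ℝ), Summable g →
      (∀ f, IsPerturbedShift e A f → ∀ n, |f (n + 2) k - f (n + 1) k| ≤ g n) →
      ∃ g : ℕ → ℝ, Summable g ∧
        ∀ f, IsPerturbedShift e A f → ∀ n, |f (n + 1) k - f n k| ≤ g n := by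
    intro k g hg h
    -- The recurrence says nothing about the increment from row 0 to row 1, which the initial data
    -- bound by `2 * A`.
    refine ⟨fun n => Nat.casesOn n (2 * A) g, (summable_nat_add_iff 1).mp hg, fun f hf n => ?_⟩
    cases n with
    | zero => exact h0 f hf k
    | succ n => exact h f hf n
  induction k using Nat.strong_induction_on with
  | _ k ih =>
    match k with
    | 0 =>
      refine extend 0 0 summable_zero fun f hf n => ?_
      rw [hf.step_zero]; simp
    | 1 =>
      refine extend 1 _ (he.mul_right B) fun f hf n => (hf.step_one n).trans ?_
      exact mul_le_mul_of_nonneg_left (by simpa using hB' f hf (n + 1) 0) (he0 n)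
    | k + 2 =>
      obtain ⟨g, hg, h⟩ := ih k (by omega)
      refine extend (k + 2) _ (hg.add (he.mul_right (B * 2 ^ k + B * 2 ^ (k + 1))))
        fun f hf n => (hf.step n k).trans ?_
      exact add_le_add (h f hf n) (mul_le_mul_of_nonneg_left
        (add_le_add (hB' f hf n k) (hB' f hf (n + 1) (k + 1))) (he0 n))

theorem tendsto_diagonal {f : ℕ → ℕ → ℝ} (he0 : ∀ n, 0 ≤ e n) (he : Summable e) (hA : 0 ≤ A)
    (hf : IsPerturbedShift e A f) (k : ℕ) :
    Tendsto (fun n => f n k) atTop (𝓝 (f 0 k + ∑' n, (f (n + 1) k - f n k))) := by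
  obtain ⟨g, hg, h⟩ := exists_increment_bound he0 he hA k
  have h1 : Summable fun n => f (n + 1) k - f n k := hg.of_norm_bounded (h f hf)
  have h2 := h1.hasSum.tendsto_sum_nat.const_add (f 0 k)
  simpa [Finset.sum_range_sub (fun n => f n k)] using h2

/-- If arrays obeying the same perturbed recurrence converge pointwise, so do their limits. -/
theorem tendsto_limit {f : ℕ → ℕ → ℝ} {fm : ℕ → ℕ → ℕ → ℝ} {L : ℕ → ℝ} {Lm : ℕ → ℕ → ℝ}
    (he0 : ∀ n, 0 ≤ e n) (he : Summable e) (hA : 0 ≤ A)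
    (hf : IsPerturbedShift e A f) (hfm : ∀ m, IsPerturbedShift e A (fm m))
    (hL : ∀ k, Tendsto (fun n => f n k) atTop (𝓝 (L k)))
    (hLm : ∀ m k, Tendsto (fun n => fm m n k) atTop (𝓝 (Lm m k)))
    (hlim : ∀ n k, Tendsto (fun m => fm m n k) atTop (𝓝 (f n k))) (k : ℕ) :
    Tendsto (fun m => Lm m k) atTop (𝓝 (L k)) := by
  -- Each limit is a telescoped series, so interchanging the limits in `m` and `n` becomes dominated
  -- convergence for series.
  have h1 := tendsto_nhds_unique (hL k) (hf.tendsto_diagonal he0 he hA k)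
  have h2 : ∀ m, Lm m k = fm m 0 k + ∑' n, (fm m (n + 1) k - fm m n k) := fun m =>
    tendsto_nhds_unique (hLm m k) ((hfm m).tendsto_diagonal he0 he hA k)
  simp only [h1, h2]
  obtain ⟨g, hg, h⟩ := exists_increment_bound he0 he hA k
  exact (hlim 0 k).add (tendsto_tsum_of_dominated_convergence hg
    (fun n => (hlim (n + 1) k).sub (hlim n k)) (Eventually.of_forall fun m n => h _ (hfm m) n))

end IsPerturbedShift

/-! ### Operators on weighted `ℓ¹` spaces given by their columns -/

namespace GeomL1

variable {r : Set.Ioi (0 : ℝ)}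

theorem weight_pos (r : Set.Ioi (0 : ℝ)) (k : ℕ) : 0 < (r : ℝ) ^ k := pow_pos r.2 k

theorem norm_coord_mul_le (v : GeomL1 r) (k : ℕ) : ‖v.coord k‖ * (r : ℝ) ^ k ≤ ‖v‖ :=
  v.summable.le_tsum k fun j _ => mul_nonneg (norm_nonneg _) (weight_pos r j).le

/-- The coordinate functionals of `ℓ¹_r`. -/
def coordCLM (r : Set.Ioi (0 : ℝ)) (k : ℕ) : GeomL1 r →L[ℂ] ℂ :=
  LinearMap.mkContinuous
    { toFun := fun v => v.coord k
      map_add' := fun v w => coord_add v w k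
      map_smul' := fun a v => coord_smul a v k } ((r : ℝ) ^ k)⁻¹ fun v => by
    rw [inv_mul_eq_div, le_div_iff₀ (weight_pos r k)]
    exact norm_coord_mul_le v k

@[simp] theorem coordCLM_apply (k : ℕ) (v : GeomL1 r) : coordCLM r k v = v.coord k := rfl

/-- The element of `ℓ¹_r` with given terms. -/
def ofSummable (f : ℕ → ℂ) (h : Summable fun k => ‖f k‖ * (r : ℝ) ^ k) : GeomL1 r :=
  Subtype.mk (p := fun x => x ∈ geomL1Submodule r) f h

@[simp] theorem coord_ofSummable (f : ℕ → ℂ) (h : Summable fun k => ‖f k‖ * (r : ℝ) ^ k) (k : ℕ) :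
    (ofSummable f h).coord k = f k := rfl

@[simp] theorem coord_sub (v w : GeomL1 r) (k : ℕ) : (v - w).coord k = v.coord k - w.coord k :=
  (coordCLM r k).map_sub v w

theorem sum_norm_coord_le (v : GeomL1 r) (N : ℕ) :
    ∑ k ∈ Finset.range N, ‖v.coord k‖ * (r : ℝ) ^ k ≤ ‖v‖ :=
  v.summable.sum_le_tsum _ fun j _ => mul_nonneg (norm_nonneg _) (weight_pos r j).le

theorem norm_le_of_sum_le {v : GeomL1 r} {a : ℝ}
    (h : ∀ N, ∑ k ∈ Finset.range N, ‖v.coord k‖ * (r : ℝ) ^ k ≤ a) : ‖v‖ ≤ a :=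
  Real.tsum_le_of_sum_range_le
    (fun k => mul_nonneg (norm_nonneg _) (weight_pos r k).le) h

/-- Completeness makes the column series `∑ v_j c_j` converge once it converges absolutely. -/
instance : CompleteSpace (GeomL1 r) := by
  refine Metric.complete_of_cauchySeq_tendsto fun u hu => ?_
  have hc : ∀ k, ∃ l : ℂ, Tendsto (fun n => (u n).coord k) atTop (𝓝 l) := fun k =>
    cauchySeq_tendsto_of_complete (hu.map (coordCLM r k).uniformContinuous)
  choose l hl using hc
  have key : ∀ ε > 0, ∃ N, ∀ n ≥ N, ∀ M,
      ∑ k ∈ Finset.range M, ‖(u n).coord k - l k‖ * (r : ℝ) ^ k ≤ ε := by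
    intro ε hε
    obtain ⟨N, hN⟩ := Metric.cauchySeq_iff.mp hu ε hε
    refine ⟨N, fun n hn M => ?_⟩
    have h1 : Tendsto (fun m => ∑ k ∈ Finset.range M, ‖(u n).coord k - (u m).coord k‖ *
        (r : ℝ) ^ k) atTop (𝓝 (∑ k ∈ Finset.range M, ‖(u n).coord k - l k‖ * (r : ℝ) ^ k)) :=
      tendsto_finsetSum _ fun k _ => ((hl k).const_sub _).norm.mul_const _
    refine le_of_tendsto h1 (eventually_atTop.mpr ⟨N, fun m hm => ?_⟩)
    have h2 := sum_norm_coord_le (u n - u m) M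
    simp only [coord_sub] at h2
    exact h2.trans (by rw [← dist_eq_norm]; exact (hN n hn m hm).le)
  have hmem : Summable fun k => ‖l k‖ * (r : ℝ) ^ k := by
    obtain ⟨N, hN⟩ := key 1 one_pos
    refine summable_of_sum_range_le (c := ‖u N‖ + 1)
      (fun k => mul_nonneg (norm_nonneg _) (weight_pos r k).le) fun M => ?_
    refine le_trans ?_ (add_le_add (sum_norm_coord_le (u N) M) (hN N le_rfl M))
    rw [← Finset.sum_add_distrib]
    refine Finset.sum_le_sum fun k _ => ?_
    rw [← add_mul]
    refine mul_le_mul_of_nonneg_right ?_ (weight_pos r k).le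
    have := norm_sub_le ((u N).coord k) ((u N).coord k - l k)
    simpa using this
  refine ⟨ofSummable l hmem, Metric.tendsto_atTop.mpr fun ε hε => ?_⟩
  obtain ⟨N, hN⟩ := key (ε / 2) (half_pos hε)
  refine ⟨N, fun n hn => ?_⟩
  rw [dist_eq_norm]
  refine lt_of_le_of_lt (norm_le_of_sum_le fun M => ?_) (half_lt_self hε)
  simpa using hN n hn M

theorem summable_smul_columns {c : ℕ → GeomL1 r} {a : ℝ} (hc : ∀ j, ‖c j‖ ≤ a * (r : ℝ) ^ j)
    (v : GeomL1 r) : Summable fun j => ‖v.coord j • c j‖ := by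
  refine Summable.of_nonneg_of_le (fun _ => norm_nonneg _) (fun j => ?_) (v.summable.mul_left a)
  rw [norm_smul]
  calc _ ≤ ‖v.coord j‖ * (a * (r : ℝ) ^ j) := mul_le_mul_of_nonneg_left (hc j) (norm_nonneg _)
    _ = _ := by ring

/-- The operator on `ℓ¹_r` with columns `c j` of norm at most `a r^j`. -/
def ofColumns (c : ℕ → GeomL1 r) (a : ℝ) (hc : ∀ j, ‖c j‖ ≤ a * (r : ℝ) ^ j) :
    GeomL1 r →L[ℂ] GeomL1 r :=
  LinearMap.mkContinuous
    { toFun := fun v => ∑' j, v.coord j • c j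
      map_add' := fun v w => by
        simp only [coord_add, add_smul]
        exact (summable_smul_columns hc v).of_norm.tsum_add (summable_smul_columns hc w).of_norm
      map_smul' := fun b v => by
        simp only [coord_smul, mul_smul, RingHom.id_apply]
        exact (summable_smul_columns hc v).of_norm.tsum_const_smul b } a fun v => by
    refine (norm_tsum_le_tsum_norm (summable_smul_columns hc v)).trans ?_
    rw [norm_def, ← tsum_mul_left]
    refine (summable_smul_columns hc v).tsum_le_tsum (fun j => ?_) (v.summable.mul_left a)
    rw [norm_smul]
    calc _ ≤ ‖v.coord j‖ * (a * (r : ℝ) ^ j) := mul_le_mul_of_nonneg_left (hc j) (norm_nonneg _)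
      _ = _ := by ring

theorem hasSum_ofColumns {c : ℕ → GeomL1 r} {a : ℝ} (hc : ∀ j, ‖c j‖ ≤ a * (r : ℝ) ^ j)
    (v : GeomL1 r) : HasSum (fun j => v.coord j • c j) (ofColumns c a hc v) :=
  (summable_smul_columns hc v).of_norm.hasSum

theorem norm_ofColumns_le {c : ℕ → GeomL1 r} {a : ℝ} (ha : 0 ≤ a)
    (hc : ∀ j, ‖c j‖ ≤ a * (r : ℝ) ^ j) : ‖ofColumns c a hc‖ ≤ a :=
  LinearMap.mkContinuous_norm_le _ ha _

theorem isMatrixOperator_ofColumns {A : Matrix ℕ ℕ ℝ} {c : ℕ → GeomL1 r} {a : ℝ}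
    (hc : ∀ j, ‖c j‖ ≤ a * (r : ℝ) ^ j) (hA : ∀ i j, (c j).coord i = A i j) :
    IsMatrixOperator A (ofColumns c a hc) := by
  intro v i
  have := (hasSum_ofColumns hc v).mapL (coordCLM r i)
  simpa [hA, mul_comm] using this

/-- An operator whose `j`-th column has norm `o(r^j)` is compact. -/
theorem isCompactOperator_ofColumns {c : ℕ → GeomL1 r} {a : ℝ}
    (hc : ∀ j, ‖c j‖ ≤ a * (r : ℝ) ^ j) {b : ℕ → ℝ} (hb : Tendsto b atTop (𝓝 0))
    (hcb : ∀ j, ‖c j‖ ≤ b j * (r : ℝ) ^ j) : IsCompactOperator (ofColumns c a hc) := by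
  let F : ℕ → GeomL1 r →L[ℂ] GeomL1 r := fun N =>
    ∑ j ∈ Finset.range N, (coordCLM r j).smulRight (c j)
  have hF : ∀ N, IsCompactOperator (F N) := fun N => by
    refine Submodule.sum_mem (compactOperator (RingHom.id ℂ) (GeomL1 r) (GeomL1 r)) ?_
    intro j _
    exact (isCompactOperator_of_locallyCompactSpace_rng
      (ContinuousLinearMap.toSpanSingleton ℂ (c j))).comp_clm (coordCLM r j)
  refine isCompactOperator_of_tendsto (l := atTop) (F := F) ?_ (Eventually.of_forall hF)
  refine Metric.tendsto_atTop.mpr fun ε hε => ?_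
  obtain ⟨N₀, hN₀⟩ := eventually_atTop.mp (hb.eventually_le_const (half_pos hε))
  refine ⟨N₀, fun N hN => ?_⟩
  -- Subtracting the finite rank operator `F N` leaves the columns from `N` on, all of relative norm
  -- at most `ε / 2`.
  let d : ℕ → GeomL1 r := fun j => if j < N then 0 else c j
  have hd : ∀ j, ‖d j‖ ≤ ε / 2 * (r : ℝ) ^ j := fun j => by
    have := weight_pos r j
    simp only [d]
    split_ifs with h
    · rw [norm_zero]; positivity
    · exact (hcb j).trans (mul_le_mul_of_nonneg_right (hN₀ j (by omega)) this.le)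
  have hsub : ofColumns c a hc - F N = ofColumns d (ε / 2) hd := by
    ext1 v
    have h1 : HasSum (fun j => if j ∈ Finset.range N then v.coord j • c j else 0) (F N v) := by
      simp only [F, sum_apply, ContinuousLinearMap.smulRight_apply,
        coordCLM_apply]
      have := hasSum_sum_of_ne_finset_zero (L := .unconditional ℕ) (s := Finset.range N)
        (f := fun j => if j ∈ Finset.range N then v.coord j • c j else 0)
        (fun j hj => if_neg hj)
      rwa [Finset.sum_congr rfl fun j hj => if_pos hj] at this
    refine ((hasSum_ofColumns hc v).sub h1).unique ?_
    convert! hasSum_ofColumns hd v using 2 with j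
    by_cases h : j < N <;> simp [d, h]
  rw [dist_comm, dist_eq_norm, hsub]
  exact (norm_ofColumns_le (half_pos hε).le hd).trans_lt (half_lt_self hε)

end GeomL1

/-! ### Toeplitz parts from convergent diagonals -/

/-- The `j`-th column of an upper triangular matrix, as an element of `ℓ¹_r`. -/
def upperColumn (r : Set.Ioi (0 : ℝ)) (A : Matrix ℕ ℕ ℝ) (hA : ∀ i j, j < i → A i j = 0)
    (j : ℕ) : GeomL1 r :=
  GeomL1.ofSummable (fun i => (A i j : ℂ)) (summable_of_ne_finset_zero (s := Finset.range (j + 1))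
    fun i hi => by rw [hA i j (by simpa using hi)]; simp)

/-- Summing a column upwards from the diagonal brings out the factor `r^j` and leaves weights
`r^{-k}` on the `k`-th diagonals, which is the form in which domination along diagonals applies. -/
theorem norm_upperColumn (r : Set.Ioi (0 : ℝ)) (A : Matrix ℕ ℕ ℝ)
    (hA : ∀ i j, j < i → A i j = 0) (j : ℕ) :
    ‖upperColumn r A hA j‖ =
      (∑' k, if k ≤ j then |A (j - k) j| * ((r : ℝ)⁻¹) ^ k else 0) * (r : ℝ) ^ j := by
  have h0 : (r : ℝ) ≠ 0 := ne_of_gt r.2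
  rw [GeomL1.norm_def, tsum_eq_sum (s := Finset.range (j + 1)),
    tsum_eq_sum (s := Finset.range (j + 1)), Finset.sum_mul, ← Finset.sum_range_reflect]
  · refine Finset.sum_congr rfl fun k hk => ?_
    have hk' : k ≤ j := by simpa [Nat.lt_succ_iff] using hk
    rw [if_pos hk', upperColumn, GeomL1.coord_ofSummable, Nat.add_sub_cancel, Complex.norm_real,
      Real.norm_eq_abs, pow_sub₀ _ h0 hk', inv_pow]
    ring
  · intro k hk
    exact if_neg (by simpa [Nat.lt_succ_iff] using hk)
  · intro k hk
    rw [upperColumn, GeomL1.coord_ofSummable, hA k j (by simpa using hk)]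
    simp

/-- The sequences `a i` are dominated, in each `ℓ¹_R` norm with `R < 1`, by one sequence. -/
def GeomDominated {ι : Type*} (a : ι → ℕ → ℝ) : Prop :=
  ∀ R : ℝ, 0 < R → R < 1 → ∃ g : ℕ → ℝ, Summable g ∧ ∀ i k, |a i k| * R ^ k ≤ g k

/-- The relative norm of column `j` of the difference is `∑_{k ≤ j} |A_{j-k,j} - t_k| R^k`. Each
term tends to zero and is at most `2 g k`, so the sum tends to zero. -/
theorem isToeplitzPart_of_dominated {A : Matrix ℕ ℕ ℝ} {t : ℕ → ℝ}
    (hA : ∀ i j, j < i → A i j = 0) (hlim : ∀ k, Tendsto (fun i => A i (i + k)) atTop (𝓝 (t k)))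
    (hdom : GeomDominated fun i k => A i (i + k)) : IsToeplitzPart A t := by
  refine ⟨hlim, fun R hR hR1 => ?_⟩
  set r : Set.Ioi (0 : ℝ) := ⟨R⁻¹, inv_pos.mpr hR⟩ with hr
  have hrR : (r : ℝ)⁻¹ = R := inv_inv R
  obtain ⟨g, hg, hgb⟩ := hdom R hR hR1
  have htg : ∀ k, |t k| * R ^ k ≤ g k := fun k =>
    le_of_tendsto ((hlim k).abs.mul_const _) (Eventually.of_forall fun i => hgb i k)
  have hg0 : ∀ k, 0 ≤ g k := fun k => le_trans (by positivity) (htg k)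
  have bound : ∀ (M : Matrix ℕ ℕ ℝ) (hM : ∀ i j, j < i → M i j = 0) (h : ℕ → ℝ), Summable h →
      (∀ i k, |M i (i + k)| * R ^ k ≤ h k) →
      ∀ j k, ‖if k ≤ j then |M (j - k) j| * R ^ k else 0‖ ≤ h k := by
    intro M hM h hh hb j k
    split_ifs with hk
    · have := hb (j - k) k
      rw [Nat.sub_add_cancel hk] at this
      rwa [Real.norm_eq_abs, abs_of_nonneg (by positivity)]
    · rw [norm_zero]
      exact le_trans (by positivity) (hb 0 k)
  have colBound : ∀ (M : Matrix ℕ ℕ ℝ) (hM : ∀ i j, j < i → M i j = 0) (h : ℕ → ℝ), Summable h →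
      (∀ i k, |M i (i + k)| * R ^ k ≤ h k) →
      ∀ j, ‖upperColumn r M hM j‖ ≤ (∑' k, h k) * (r : ℝ) ^ j := by
    intro M hM h hh hb j
    rw [norm_upperColumn, hrR]
    refine mul_le_mul_of_nonneg_right ?_ (GeomL1.weight_pos r j).le
    have h1 := bound M hM h hh hb j
    exact (hh.of_norm_bounded h1).tsum_le_tsum (fun k => (le_abs_self _).trans (h1 k)) hh
  have hT : ∀ i j, j < i → upperToeplitz t i j = 0 := fun i j hij => if_neg (by omega)
  have hTd : ∀ i k, upperToeplitz t i (i + k) = t k := fun i k => by simp [upperToeplitz]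
  have hD : ∀ i j, j < i → (A - upperToeplitz t) i j = 0 := fun i j hij => by
    rw [Matrix.sub_apply, hA i j hij, hT i j hij, sub_zero]
  have hDb : ∀ i k, |(A - upperToeplitz t) i (i + k)| * R ^ k ≤ 2 * g k := fun i k => by
    rw [Matrix.sub_apply, hTd]
    have h1 := mul_le_mul_of_nonneg_right (abs_sub (A i (i + k)) (t k)) (pow_nonneg hR.le k)
    have h2 := hgb i k
    have h3 := htg k
    linarith
  refine ⟨⟨_, GeomL1.isMatrixOperator_ofColumns
      (colBound _ hT g hg fun i k => by rw [hTd]; exact htg k) fun i j => rfl⟩,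
    ⟨_, GeomL1.isMatrixOperator_ofColumns (colBound _ hD _ (hg.mul_left 2) hDb) fun i j => rfl,
      GeomL1.isCompactOperator_ofColumns _ ?_ fun j => (norm_upperColumn r _ hD j).le⟩⟩
  rw [hrR]
  have h0 : Tendsto (fun j => ∑' k, if k ≤ j then |(A - upperToeplitz t) (j - k) j| * R ^ k else 0)
      atTop (𝓝 (∑' _ : ℕ, (0 : ℝ))) := by
    refine tendsto_tsum_of_dominated_convergence (hg.mul_left 2) (fun k => ?_)
      (Eventually.of_forall (bound _ hD _ (hg.mul_left 2) hDb))
    -- With `j = i + k` the condition `k ≤ j` always holds and the term lies on the `k`-th diagonal.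
    rw [← tendsto_add_atTop_iff_nat k]
    have h1 : Tendsto (fun i => |A i (i + k) - t k| * R ^ k) atTop (𝓝 0) := by
      simpa using ((hlim k).sub_const (t k)).abs.mul_const (R ^ k)
    refine h1.congr fun i => ?_
    rw [if_pos (by omega), Nat.add_sub_cancel, Matrix.sub_apply, hTd]
  rwa [tsum_zero] at h0

/-! ### Toeplitz symbols -/

theorem norm_symbol_term_le (t : ℕ → ℝ) {z : ℂ} {R : ℝ} (hz : ‖z‖ ≤ R) (k : ℕ) :
    ‖(t k : ℂ) * z ^ k‖ ≤ |t k| * R ^ k := by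
  rw [norm_mul, norm_pow, Complex.norm_real, Real.norm_eq_abs]
  exact mul_le_mul_of_nonneg_left (pow_le_pow_left₀ (norm_nonneg _) hz k) (abs_nonneg _)

namespace GeomDominated

variable {ι : Type*} {t : ι → ℕ → ℝ}

theorem symbolConverges (h : GeomDominated t) (i : ι) : SymbolConverges (t i) := by
  intro z hz
  obtain ⟨R, hzR, hR1⟩ := exists_between (mem_ball_zero_iff.mp hz)
  obtain ⟨g, hg, hb⟩ := h R ((norm_nonneg z).trans_lt hzR) hR1
  exact hg.of_nonneg_of_le (fun _ => norm_nonneg _)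
    fun k => (norm_symbol_term_le (t i) hzR.le k).trans (hb i k)

theorem analyticOnNhd_toeplitzSymbol (h : GeomDominated t) (i : ι) :
    AnalyticOnNhd ℂ (toeplitzSymbol (t i)) (Metric.ball 0 1) := by
  intro z hz
  obtain ⟨R, hzR, hR1⟩ := exists_between (mem_ball_zero_iff.mp hz)
  obtain ⟨g, hg, hb⟩ := h R ((norm_nonneg z).trans_lt hzR) hR1
  have hd : DifferentiableOn ℂ (toeplitzSymbol (t i)) (Metric.ball 0 R) := by
    refine Complex.differentiableOn_tsum_of_summable_norm hg (fun k => by fun_prop)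
      Metric.isOpen_ball fun k w hw => ?_
    exact (norm_symbol_term_le (t i) (mem_ball_zero_iff.mp hw).le k).trans (hb i k)
  exact hd.analyticOnNhd Metric.isOpen_ball z (mem_ball_zero_iff.mpr hzR)

/-- Pointwise convergence of dominated coefficient sequences gives locally uniform convergence of
the symbols. -/
theorem tendstoUniformlyOn_toeplitzSymbol {tm : ℕ → ℕ → ℝ} (h : GeomDominated tm) {s : ℕ → ℝ}
    (hs : ∀ k, Tendsto (fun m => tm m k) atTop (𝓝 (s k))) {K : Set ℂ} (hK : IsCompact K)
    (hK1 : K ⊆ Metric.ball 0 1) :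
    TendstoUniformlyOn (fun m => toeplitzSymbol (tm m)) (toeplitzSymbol s) atTop K := by
  obtain ⟨R, hR0, hR1, hKR⟩ : ∃ R : ℝ, 0 < R ∧ R < 1 ∧ ∀ z ∈ K, ‖z‖ ≤ R := by
    rcases K.eq_empty_or_nonempty with rfl | hne
    · exact ⟨1 / 2, by norm_num, by norm_num, by simp⟩
    · obtain ⟨w, hw, hmax⟩ := hK.exists_isMaxOn hne continuous_norm.continuousOn
      obtain ⟨R, hwR, hR1⟩ := exists_between (mem_ball_zero_iff.mp (hK1 hw))
      exact ⟨R, (norm_nonneg w).trans_lt hwR, hR1, fun z hz => (hmax hz).trans hwR.le⟩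
  obtain ⟨g, hg, hb⟩ := h R hR0 hR1
  have hsb : ∀ k, |s k| * R ^ k ≤ g k := fun k =>
    le_of_tendsto ((hs k).abs.mul_const _) (Eventually.of_forall fun m => hb m k)
  have hdb : ∀ m k, |s k - tm m k| * R ^ k ≤ 2 * g k := fun m k => by
    have h1 := mul_le_mul_of_nonneg_right (abs_sub (s k) (tm m k)) (pow_nonneg hR0.le k)
    have h2 := hb m k
    have h3 := hsb k
    linarith
  -- This sum bounds the difference of the symbols at every point of `K` at once.
  have hlim : Tendsto (fun m => ∑' k, |s k - tm m k| * R ^ k) atTop (𝓝 0) := by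
    rw [← tsum_zero (α := ℝ) (β := ℕ)]
    refine tendsto_tsum_of_dominated_convergence (hg.mul_left 2) (fun k => ?_)
      (Eventually.of_forall fun m k => ?_)
    · simpa using ((hs k).const_sub (s k)).abs.mul_const (R ^ k)
    · rw [Real.norm_eq_abs, abs_of_nonneg (by positivity)]
      exact hdb m k
  rw [Metric.tendstoUniformlyOn_iff]
  intro ε hε
  filter_upwards [hlim.eventually_lt_const hε] with m hm z hz
  have hsum : ∀ a : ℕ → ℝ, (∀ k, |a k| * R ^ k ≤ 2 * g k) → Summable fun k => (a k : ℂ) * z ^ k :=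
    fun a ha => (hg.mul_left 2).of_norm_bounded
      fun k => (norm_symbol_term_le a (hKR z hz) k).trans (ha k)
  have hg0 : ∀ k, 0 ≤ g k := fun k => le_trans (by positivity) (hsb k)
  rw [dist_eq_norm, toeplitzSymbol, toeplitzSymbol,
    ← (hsum s fun k => by linarith [hsb k, hg0 k]).tsum_sub
      (hsum (tm m) fun k => by linarith [hb m k, hg0 k])]
  refine lt_of_le_of_lt (tsum_of_norm_bounded (((hg.mul_left 2).of_nonneg_of_le
    (fun k => by positivity) (hdb m)).hasSum) fun k => ?_) hm
  rw [← sub_mul, ← Complex.ofReal_sub]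
  exact norm_symbol_term_le (fun k => s k - tm m k) (hKR z hz) k

end GeomDominated

namespace JacobiOperator

/-! ### The recurrence for connection coefficients -/

/-- The coefficient of `Q_i` in the expansion of a polynomial in the orthonormal polynomials of the
free Jacobi operator. -/
def freeCoeff (i : ℕ) : ℝ[X] →ₗ[ℝ] ℝ := free.orthoBasis.coord i

theorem changeMatrix_eq_freeCoeff (p : ℕ → ℝ[X]) (i j : ℕ) :
    changeMatrix p free i j = freeCoeff i (p j) := rfl

theorem freeCoeff_orthoPoly (i j : ℕ) :
    freeCoeff i (free.orthoPoly j) = if j = i then 1 else 0 := by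
  rw [freeCoeff, ← orthoBasis_apply, Module.Basis.coord_apply, Module.Basis.repr_self,
    Finsupp.single_apply]

theorem freeCoeff_C_mul (i : ℕ) (a : ℝ) (q : ℝ[X]) :
    freeCoeff i (C a * q) = a * freeCoeff i q := by
  rw [← smul_eq_C_mul, map_smul, smul_eq_mul]

theorem X_mul_free_zero : X * free.orthoPoly 0 = C (1 / 2) * free.orthoPoly 1 := by
  simpa [free] using X_mul_orthoPoly_zero free

theorem X_mul_free_succ (k : ℕ) : X * free.orthoPoly (k + 1) =
    C (1 / 2) * free.orthoPoly k + C (1 / 2) * free.orthoPoly (k + 2) := by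
  simpa [free] using X_mul_orthoPoly_succ free k

theorem freeCoeff_zero_X_mul (q : ℝ[X]) : freeCoeff 0 (X * q) = 1 / 2 * freeCoeff 1 q := by
  have h : freeCoeff 0 ∘ₗ LinearMap.mulLeft ℝ X = (1 / 2 : ℝ) • freeCoeff 1 := by
    refine free.orthoBasis.ext fun j => ?_
    simp only [orthoBasis_apply, LinearMap.comp_apply, LinearMap.mulLeft_apply,
      LinearMap.smul_apply, smul_eq_mul]
    cases j with
    | zero => simp [X_mul_free_zero, freeCoeff_C_mul, freeCoeff_orthoPoly]
    | succ j => simp [X_mul_free_succ, freeCoeff_C_mul, freeCoeff_orthoPoly]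
  exact LinearMap.congr_fun h q

/-- `X` acts on the basis by the symmetric matrix `Δ`, so a coefficient of `X * q` is read off from
a row of `Δ`. Both sides are linear in `q`, and basis vectors suffice. -/
theorem freeCoeff_succ_X_mul (i : ℕ) (q : ℝ[X]) :
    freeCoeff (i + 1) (X * q) = 1 / 2 * (freeCoeff (i + 2) q + freeCoeff i q) := by
  have h : freeCoeff (i + 1) ∘ₗ LinearMap.mulLeft ℝ X =
      (1 / 2 : ℝ) • (freeCoeff (i + 2) + freeCoeff i) := by
    refine free.orthoBasis.ext fun j => ?_
    simp only [orthoBasis_apply, LinearMap.comp_apply, LinearMap.mulLeft_apply,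
      LinearMap.smul_apply, LinearMap.add_apply, smul_eq_mul]
    cases j with
    | zero =>
      simp only [X_mul_free_zero, freeCoeff_C_mul, freeCoeff_orthoPoly]
      grind
    | succ j =>
      simp only [X_mul_free_succ, map_add, freeCoeff_C_mul, freeCoeff_orthoPoly]
      grind
  exact LinearMap.congr_fun h q

/-- The products `∏_{j < n} 2 β_j`. -/
def weight (J : JacobiOperator) (n : ℕ) : ℝ := ∏ j ∈ Finset.range n, 2 * J.β j

theorem weight_succ (J : JacobiOperator) (n : ℕ) :
    J.weight (n + 1) = J.weight n * (2 * J.β n) := Finset.prod_range_succ _ _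

theorem weight_pos (J : JacobiOperator) (n : ℕ) : 0 < J.weight n :=
  Finset.prod_pos fun j _ => mul_pos two_pos (J.β_pos j)

/-- The size of the `n`-th perturbation of the free recurrence. -/
def perturbation (J : JacobiOperator) (n : ℕ) : ℝ := |1 - 4 * J.β n ^ 2| + 2 * |J.α (n + 1)|

theorem perturbation_nonneg (J : JacobiOperator) (n : ℕ) : 0 ≤ J.perturbation n := by
  unfold perturbation
  positivity

/-- The connection coefficients `c_{n-k, n}` of a family `p`, scaled by `∏_{j < n} 2 β_j`. -/
def diagArray (J : JacobiOperator) (p : ℕ → ℝ[X]) (n k : ℕ) : ℝ :=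
  if k ≤ n then J.weight n * changeMatrix p free (n - k) n else 0

theorem diagArray_add (J : JacobiOperator) (p : ℕ → ℝ[X]) (i k : ℕ) :
    J.diagArray p (i + k) k = J.weight (i + k) * changeMatrix p free i (i + k) := by
  rw [diagArray, if_pos (by omega), Nat.add_sub_cancel]

theorem diagArray_of_lt (J : JacobiOperator) (p : ℕ → ℝ[X]) {n k : ℕ} (h : n < k) :
    J.diagArray p n k = 0 := if_neg (by omega)

section Recurrence

variable {J : JacobiOperator} {p : ℕ → ℝ[X]}
  (hdeg : ∀ k : ℕ, (p k).degree < ((k + 1 : ℕ) : WithBot ℕ))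
  (hrec : ∀ k, X * p (k + 1) = C (J.β k) * p k + C (J.α (k + 1)) * p (k + 1)
    + C (J.β (k + 1)) * p (k + 2))

include hrec in
theorem changeMatrix_zero_rec (n : ℕ) :
    1 / 2 * changeMatrix p free 1 (n + 1) = J.β n * changeMatrix p free 0 n
      + J.α (n + 1) * changeMatrix p free 0 (n + 1) + J.β (n + 1) * changeMatrix p free 0 (n + 2) := by
  simp only [changeMatrix_eq_freeCoeff, ← freeCoeff_zero_X_mul, hrec, map_add, freeCoeff_C_mul]

-- The entry of `ΔC = CJ` in row `i + 1` and column `n + 1`.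
include hrec in
theorem changeMatrix_succ_rec (i n : ℕ) :
    1 / 2 * (changeMatrix p free (i + 2) (n + 1) + changeMatrix p free i (n + 1)) =
      J.β n * changeMatrix p free (i + 1) n + J.α (n + 1) * changeMatrix p free (i + 1) (n + 1)
      + J.β (n + 1) * changeMatrix p free (i + 1) (n + 2) := by
  simp only [changeMatrix_eq_freeCoeff, ← freeCoeff_succ_X_mul, hrec, map_add, freeCoeff_C_mul]

-- Below the diagonal everything vanishes, leaving `c_{n+1,n+1} = 2β_{n+1} c_{n+2,n+2}`; the weights
-- are chosen to absorb this factor.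
include hdeg hrec in
theorem diagArray_step_zero (n : ℕ) : J.diagArray p (n + 2) 0 = J.diagArray p (n + 1) 0 := by
  have h := changeMatrix_succ_rec hrec (n + 1) n
  rw [changeMatrix_eq_zero p free hdeg (show n + 1 < n + 1 + 2 by omega),
    changeMatrix_eq_zero p free hdeg (show n < n + 1 + 1 by omega),
    changeMatrix_eq_zero p free hdeg (show n + 1 < n + 1 + 1 by omega)] at h
  simp only [diagArray, zero_le, if_true, Nat.sub_zero, J.weight_succ (n + 1)]
  linear_combination (-2 * J.weight (n + 1)) * h

include hdeg hrec in
theorem diagArray_step_one (n : ℕ) :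
    J.diagArray p (n + 2) 1 - J.diagArray p (n + 1) 1 =
      -(2 * J.α (n + 1)) * J.diagArray p (n + 1) 0 := by
  have h := changeMatrix_succ_rec hrec n n
  rw [changeMatrix_eq_zero p free hdeg (show n + 1 < n + 2 by omega),
    changeMatrix_eq_zero p free hdeg (show n < n + 1 by omega)] at h
  have h2 : J.diagArray p (n + 2) 1 = J.weight (n + 2) * changeMatrix p free (n + 1) (n + 2) :=
    J.diagArray_add p (n + 1) 1
  have h1 : J.diagArray p (n + 1) 1 = J.weight (n + 1) * changeMatrix p free n (n + 1) :=
    J.diagArray_add p n 1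
  have h0 : J.diagArray p (n + 1) 0 = J.weight (n + 1) * changeMatrix p free (n + 1) (n + 1) :=
    J.diagArray_add p (n + 1) 0
  rw [h2, h1, h0, J.weight_succ (n + 1)]
  linear_combination (-2 * J.weight (n + 1)) * h

-- This is `2 w_{n+1}` times row `n - k`, column `n + 1` of `ΔC = CJ`. The coefficient `4β_n²`
-- arises from `2 w_{n+1} β_n = 4β_n² w_n`.
include hrec in
theorem diagArray_step (n k : ℕ) (hk : k ≤ n) :
    J.diagArray p (n + 2) (k + 2) - J.diagArray p (n + 1) (k + 2) =
      (J.diagArray p (n + 1) k - J.diagArray p n k) + (1 - 4 * J.β n ^ 2) * J.diagArray p n k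
        - 2 * J.α (n + 1) * J.diagArray p (n + 1) (k + 1) := by
  obtain ⟨i, rfl⟩ := Nat.exists_eq_add_of_le' hk
  have h4 : J.diagArray p (i + k + 2) (k + 2) =
      J.weight (i + k + 2) * changeMatrix p free i (i + k + 2) := J.diagArray_add p i (k + 2)
  have h3 : J.diagArray p (i + k + 1) (k + 1) =
      J.weight (i + k + 1) * changeMatrix p free i (i + k + 1) := J.diagArray_add p i (k + 1)
  have h2 : J.diagArray p (i + k + 1) k =
      J.weight (i + k + 1) * changeMatrix p free (i + 1) (i + k + 1) := by
    have := J.diagArray_add p (i + 1) k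
    rwa [show i + 1 + k = i + k + 1 by omega] at this
  rw [h4, h3, h2, J.diagArray_add p i k, J.weight_succ (i + k + 1), J.weight_succ (i + k)]
  cases i with
  | zero =>
    -- Row 0 of `Δ` has no left neighbour; the default value zero of `diagArray` stands in for the
    -- missing entry.
    rw [J.diagArray_of_lt p (show 0 + k + 1 < k + 2 by omega)]
    have h := changeMatrix_zero_rec hrec (0 + k)
    linear_combination (-4 * J.weight (0 + k) * J.β (0 + k)) * h
  | succ i =>
    have h1 : J.diagArray p (i + 1 + k + 1) (k + 2) =
        J.weight (i + 1 + k + 1) * changeMatrix p free i (i + 1 + k + 1) := by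
      have := J.diagArray_add p i (k + 2)
      rwa [show i + (k + 2) = i + 1 + k + 1 by omega] at this
    have h := changeMatrix_succ_rec hrec i (i + 1 + k)
    rw [h1, J.weight_succ (i + 1 + k)]
    linear_combination (-4 * J.weight (i + 1 + k) * J.β (i + 1 + k)) * h

include hdeg hrec in
theorem isPerturbedShift_diagArray {A : ℝ} (h0 : ∀ k, |J.diagArray p 0 k| ≤ A)
    (h1 : ∀ k, |J.diagArray p 1 k| ≤ A) : IsPerturbedShift J.perturbation A (J.diagArray p) where
  init_zero := h0
  init_one := h1
  step_zero := diagArray_step_zero hdeg hrec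
  step_one n := by
    rw [diagArray_step_one hdeg hrec, abs_mul]
    refine mul_le_mul_of_nonneg_right ?_ (abs_nonneg _)
    rw [abs_neg, abs_mul, abs_two, perturbation]
    exact le_add_of_nonneg_left (abs_nonneg _)
  step n k := by
    by_cases hk : k ≤ n
    · rw [diagArray_step hrec n k hk, perturbation]
      set a := J.diagArray p n k
      set b := J.diagArray p (n + 1) k
      set c := J.diagArray p (n + 1) (k + 1)
      have t1 := abs_sub (b - a + (1 - 4 * J.β n ^ 2) * a) (2 * J.α (n + 1) * c)
      have t2 := abs_add_le (b - a) ((1 - 4 * J.β n ^ 2) * a)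
      rw [abs_mul (1 - 4 * J.β n ^ 2)] at t2
      rw [abs_mul (2 * J.α (n + 1)), abs_mul, abs_two] at t1
      have p1 : 0 ≤ |1 - 4 * J.β n ^ 2| * |c| := by positivity
      have p2 : 0 ≤ |J.α (n + 1)| * |a| := by positivity
      linarith
    · rw [J.diagArray_of_lt p (show n + 2 < k + 2 by omega),
        J.diagArray_of_lt p (show n + 1 < k + 2 by omega), sub_zero, abs_zero]
      have := J.perturbation_nonneg n
      positivity

end Recurrence

/-! ### Weights and truncations -/

theorem summable_abs_beta_sub {J : JacobiOperator} (hJ : J.IsToeplitzPlusTraceClass) :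
    Summable fun k => |J.β k - 1 / 2| :=
  hJ.of_nonneg_of_le (fun _ => abs_nonneg _) fun _ => le_add_of_nonneg_right (abs_nonneg _)

/-- `1 - 4β²` has the factor `β - 1/2`, and its cofactor is bounded because `β` is. -/
theorem summable_perturbation {J : JacobiOperator} (hJ : J.IsToeplitzPlusTraceClass) :
    Summable J.perturbation := by
  obtain ⟨M, hM⟩ := J.bounded
  have hα : Summable fun k => |J.α k| :=
    hJ.of_nonneg_of_le (fun _ => abs_nonneg _) fun _ => le_add_of_nonneg_left (abs_nonneg _)
  refine Summable.add ?_ (((summable_nat_add_iff 1).mpr hα).mul_left 2)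
  refine ((summable_abs_beta_sub hJ).mul_left (4 * M + 2)).of_nonneg_of_le
    (fun _ => abs_nonneg _) fun n => ?_
  rw [show 1 - 4 * J.β n ^ 2 = -((4 * J.β n + 2) * (J.β n - 1 / 2)) by ring, abs_neg, abs_mul]
  refine mul_le_mul_of_nonneg_right ?_ (abs_nonneg _)
  have h1 := (hM n).2
  have h2 := J.β_pos n
  rw [abs_of_pos h2] at h1
  rw [abs_of_pos (by positivity)]
  linarith

/-- The logarithms of the factors `1 + 2(β_j - 1/2)` are summable, so the limit is an exponential
and hence positive. -/
theorem exists_tendsto_weight {J : JacobiOperator} (hJ : J.IsToeplitzPlusTraceClass) :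
    ∃ G : ℝ, 0 < G ∧ Tendsto J.weight atTop (𝓝 G) := by
  have h1 : Summable fun k => 2 * (J.β k - 1 / 2) := (summable_abs_beta_sub hJ).of_abs.mul_left 2
  have h2 := (Real.summable_log_one_add_of_summable h1).hasSum.tendsto_sum_nat
  refine ⟨_, Real.exp_pos _, ((Real.continuous_exp.tendsto _).comp h2).congr fun n => ?_⟩
  rw [Function.comp_apply, Real.exp_sum, weight]
  refine Finset.prod_congr rfl fun j _ => ?_
  have := J.β_pos j
  rw [show 1 + 2 * (J.β j - 1 / 2) = 2 * J.β j by ring, Real.exp_log (by positivity)]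

theorem exists_pos_le_weight {J : JacobiOperator} (hJ : J.IsToeplitzPlusTraceClass) :
    ∃ δ : ℝ, 0 < δ ∧ ∀ n, δ ≤ J.weight n := by
  obtain ⟨G, hG, h⟩ := exists_tendsto_weight hJ
  obtain ⟨B, hB⟩ := (h.inv₀ hG.ne').bddAbove_range
  have hB' : ∀ n, (J.weight n)⁻¹ ≤ B := fun n => hB ⟨n, rfl⟩
  have hB0 : 0 < B := (inv_pos.mpr (J.weight_pos 0)).trans_le (hB' 0)
  exact ⟨B⁻¹, inv_pos.mpr hB0, fun n => inv_le_of_inv_le₀ (J.weight_pos n) (hB' n)⟩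

/-- Only `β_k` with `k + 1 < m` survive, that is `m - 1` of them, and every other factor is `2 · 1/2
= 1`. Thus the weights of a truncation are among those of `J` and inherit their lower bound. -/
theorem weight_truncation (J : JacobiOperator) (m n : ℕ) :
    (J.truncation m).weight n = J.weight (min n (m - 1)) := by
  induction n with
  | zero => simp [weight]
  | succ n ih =>
    rw [weight_succ, ih, truncation]
    dsimp only
    split_ifs with h
    · rw [min_eq_left (by omega), min_eq_left (by omega), weight_succ]
    · rw [min_eq_right (by omega), min_eq_right (by omega)]
      ring

theorem tendsto_weight_truncation (J : JacobiOperator) (m : ℕ) :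
    Tendsto (J.truncation m).weight atTop (𝓝 (J.weight (m - 1))) := by
  refine tendsto_const_nhds.congr' (eventually_atTop.mpr ⟨m, fun n hn => ?_⟩)
  rw [weight_truncation, min_eq_right (by omega)]

/-- A free entry contributes `1 - 4 (1/2)² = 0` or `α = 0`, so one error sequence controls all
truncations. -/
theorem perturbation_truncation_le (J : JacobiOperator) (m n : ℕ) :
    (J.truncation m).perturbation n ≤ J.perturbation n := by
  rw [perturbation, perturbation, truncation]
  refine add_le_add ?_ (mul_le_mul_of_nonneg_left ?_ zero_le_two)
  · dsimp only
    split_ifs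
    · exact le_rfl
    · norm_num
  · dsimp only
    split_ifs
    · exact le_rfl
    · simp

theorem abs_alpha_truncation_le (J : JacobiOperator) (m n : ℕ) :
    |(J.truncation m).α n| ≤ |J.α n| := by
  rw [truncation]
  dsimp only
  split_ifs
  · exact le_rfl
  · simp

/-! ### Families of polynomials attached to Jacobi operators -/

/-- A family of polynomials attached to every Jacobi operator by the three term recurrence, with
controlled initial values, and depending only on the leading section of the operator. -/
structure IsRecurrentFamily (p : JacobiOperator → ℕ → ℝ[X]) : Prop where
  degree_lt : ∀ (J : JacobiOperator) (k : ℕ), (p J k).degree < ((k + 1 : ℕ) : WithBot ℕ)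
  X_mul_succ : ∀ (J : JacobiOperator) (k : ℕ), X * p J (k + 1) =
    C (J.β k) * p J k + C (J.α (k + 1)) * p J (k + 1) + C (J.β (k + 1)) * p J (k + 2)
  local_eq : ∀ (J J' : JacobiOperator) (n : ℕ),
    (∀ k < n, J.α k = J'.α k ∧ J.β k = J'.β k) → p J n = p J' n
  init_zero : ∀ (J : JacobiOperator) (k : ℕ), |J.diagArray (p J) 0 k| ≤ 2 + 2 * |J.α 0|
  init_one : ∀ (J : JacobiOperator) (k : ℕ), |J.diagArray (p J) 1 k| ≤ 2 + 2 * |J.α 0|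

theorem orthoPoly_local (J J' : JacobiOperator) : ∀ n : ℕ,
    (∀ k < n, J.α k = J'.α k ∧ J.β k = J'.β k) → J.orthoPoly n = J'.orthoPoly n
  | 0, _ => rfl
  | 1, h => by rw [orthoPoly, orthoPoly, (h 0 one_pos).1, (h 0 one_pos).2]
  | n + 2, h => by
    rw [orthoPoly, orthoPoly, orthoPoly_local J J' (n + 1) fun k hk => h k (by omega),
      orthoPoly_local J J' n fun k hk => h k (by omega), (h (n + 1) (by omega)).1,
      (h (n + 1) (by omega)).2, (h n (by omega)).2]

theorem assocPoly_local (J J' : JacobiOperator) : ∀ n : ℕ,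
    (∀ k < n, J.α k = J'.α k ∧ J.β k = J'.β k) → J.assocPoly n = J'.assocPoly n
  | 0, _ => rfl
  | 1, h => by rw [assocPoly, assocPoly, (h 0 one_pos).2]
  | n + 2, h => by
    rw [assocPoly, assocPoly, assocPoly_local J J' (n + 1) fun k hk => h k (by omega),
      assocPoly_local J J' n fun k hk => h k (by omega), (h (n + 1) (by omega)).1,
      (h (n + 1) (by omega)).2, (h n (by omega)).2]

theorem freeCoeff_one (i : ℕ) : freeCoeff i 1 = if i = 0 then 1 else 0 := by
  have := freeCoeff_orthoPoly i 0
  rw [orthoPoly] at this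
  rw [this]
  simp [eq_comm]

theorem freeCoeff_C (i : ℕ) (a : ℝ) : freeCoeff i (C a) = if i = 0 then a else 0 := by
  rw [← mul_one (C a), freeCoeff_C_mul, freeCoeff_one]
  simp

theorem freeCoeff_X (i : ℕ) : freeCoeff i X = if i = 1 then 1 / 2 else 0 := by
  have h := X_mul_free_zero
  rw [orthoPoly, mul_one] at h
  rw [h, freeCoeff_C_mul, freeCoeff_orthoPoly]
  simp [eq_comm]

/-- The nonzero part of the first two rows of the scaled array is `1` and `1, -2α_0`; for the
associated polynomials it is `2` alone. The common bound `2 + 2|α_0|` covers both. -/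
theorem isRecurrentFamily_orthoPoly : IsRecurrentFamily orthoPoly where
  degree_lt J k := by rw [degree_orthoPoly]; norm_cast; omega
  X_mul_succ := X_mul_orthoPoly_succ
  local_eq := orthoPoly_local
  init_zero J k := by
    have := abs_nonneg (J.α 0)
    rcases k with - | k
    · simp only [diagArray, changeMatrix_eq_freeCoeff, weight, orthoPoly, freeCoeff_one]
      simp
      linarith
    · rw [diagArray_of_lt _ _ (by omega), abs_zero]
      positivity
  init_one J k := by
    have := abs_nonneg (J.α 0)
    have hβ := (J.β_pos 0).ne'
    rcases k with - | - | k
    · have h : J.diagArray J.orthoPoly 1 0 = 1 := by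
        simp only [diagArray, changeMatrix_eq_freeCoeff, weight, orthoPoly, freeCoeff_C_mul,
          map_sub, freeCoeff_X, freeCoeff_C]
        simp
        field_simp
      rw [h, abs_one]
      linarith
    · have h : J.diagArray J.orthoPoly 1 1 = -(2 * J.α 0) := by
        simp only [diagArray, changeMatrix_eq_freeCoeff, weight, orthoPoly, freeCoeff_C_mul,
          map_sub, freeCoeff_X, freeCoeff_C]
        simp
        field_simp
      rw [zero_add, h, abs_neg, abs_mul, abs_two]
      linarith
    · rw [diagArray_of_lt _ _ (by omega), abs_zero]
      positivity

theorem isRecurrentFamily_assocPoly : IsRecurrentFamily assocPoly where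
  degree_lt := degree_assocPoly_lt
  X_mul_succ := X_mul_assocPoly_succ
  local_eq := assocPoly_local
  init_zero J k := by
    have h : J.diagArray J.assocPoly 0 k = 0 := by
      simp [diagArray, changeMatrix_eq_freeCoeff, assocPoly]
    rw [h, abs_zero]
    positivity
  init_one J k := by
    have := abs_nonneg (J.α 0)
    have hβ := (J.β_pos 0).ne'
    rcases k with - | - | k
    · have h : J.diagArray J.assocPoly 1 0 = 0 := by
        simp [diagArray, changeMatrix_eq_freeCoeff, assocPoly, freeCoeff_C]
      rw [h, abs_zero]
      positivity
    · have h : J.diagArray J.assocPoly 1 1 = 2 := by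
        simp only [diagArray, changeMatrix_eq_freeCoeff, weight, assocPoly, freeCoeff_C]
        simp
        field_simp
      rw [zero_add, h, abs_two]
      linarith
    · rw [diagArray_of_lt _ _ (by omega), abs_zero]
      positivity

theorem diagArray_truncation {p : JacobiOperator → ℕ → ℝ[X]} (hp : IsRecurrentFamily p)
    (J : JacobiOperator) {m n : ℕ} (h : n < m) (k : ℕ) :
    (J.truncation m).diagArray (p (J.truncation m)) n k = J.diagArray (p J) n k := by
  have h1 : p (J.truncation m) n = p J n := hp.local_eq _ _ n fun k hk => by
    simp only [truncation]
    exact ⟨if_pos (by omega), if_pos (by omega)⟩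
  rw [diagArray, diagArray, weight_truncation, min_eq_left (by omega), changeMatrix_eq_freeCoeff,
    changeMatrix_eq_freeCoeff, h1]

/-- The connection coefficient matrices of a recurrent family for `J` and its truncations have
Toeplitz parts, uniformly dominated, and those of the truncations converge. -/
theorem exists_toeplitzParts {p : JacobiOperator → ℕ → ℝ[X]} (hp : IsRecurrentFamily p)
    {J : JacobiOperator} (hJ : J.IsToeplitzPlusTraceClass) :
    ∃ (t : ℕ → ℝ) (tm : ℕ → ℕ → ℝ), IsToeplitzPart (changeMatrix (p J) free) t ∧
      (∀ m, IsToeplitzPart (changeMatrix (p (J.truncation m)) free) (tm m)) ∧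
      GeomDominated (fun _ : Unit => t) ∧ GeomDominated tm ∧
      ∀ k, Tendsto (fun m => tm m k) atTop (𝓝 (t k)) := by
  have he0 := J.perturbation_nonneg
  have he := summable_perturbation hJ
  have hA : 0 ≤ 2 + 2 * |J.α 0| := by positivity
  have hf : IsPerturbedShift J.perturbation (2 + 2 * |J.α 0|) (J.diagArray (p J)) :=
    isPerturbedShift_diagArray (hp.degree_lt J) (hp.X_mul_succ J) (hp.init_zero J) (hp.init_one J)
  have hfm : ∀ m, IsPerturbedShift J.perturbation (2 + 2 * |J.α 0|)
      ((J.truncation m).diagArray (p (J.truncation m))) := fun m => by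
    have hα := J.abs_alpha_truncation_le m 0
    refine (isPerturbedShift_diagArray (hp.degree_lt _) (hp.X_mul_succ _)
      (fun k => (hp.init_zero _ k).trans (by linarith))
      (fun k => (hp.init_one _ k).trans (by linarith))).mono (J.perturbation_truncation_le m)
  obtain ⟨G, hG, hGlim⟩ := exists_tendsto_weight hJ
  obtain ⟨δ, hδ, hδle⟩ := exists_pos_le_weight hJ
  -- Stated for any `J'` obeying the bounds of `J`, so as to apply to `J` itself and to each
  -- truncation with the same `δ`.
  have part : ∀ (J' : JacobiOperator) (G' : ℝ),
      IsPerturbedShift J.perturbation (2 + 2 * |J.α 0|) (J'.diagArray (p J')) →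
      Tendsto J'.weight atTop (𝓝 G') → (∀ n, δ ≤ J'.weight n) → δ ≤ G' →
      ∀ L : ℕ → ℝ, (∀ k, Tendsto (fun n => J'.diagArray (p J') n k) atTop (𝓝 (L k))) →
        IsToeplitzPart (changeMatrix (p J') free) fun k => L k / G' := by
    intro J' G' hf' hG' hδ' hδG' L hL
    have hc : ∀ i k, changeMatrix (p J') free i (i + k) =
        J'.diagArray (p J') (i + k) k / J'.weight (i + k) := fun i k => by
      rw [diagArray_add, mul_div_cancel_left₀ _ (J'.weight_pos _).ne']
    refine isToeplitzPart_of_dominated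
      (fun i j hij => changeMatrix_eq_zero _ _ (hp.degree_lt J') hij) (fun k => ?_) ?_
    · simp only [hc]
      exact ((hL k).comp (tendsto_add_atTop_nat k)).div (hG'.comp (tendsto_add_atTop_nat k))
        (hδ.trans_le hδG').ne'
    · intro R hR0 hR1
      obtain ⟨g, hg, hb⟩ := IsPerturbedShift.exists_summable_bound he0 he hA hR0 hR1
      refine ⟨fun k => g k / δ, hg.div_const δ, fun i k => ?_⟩
      have h1 := hb _ hf' (i + k) k
      change |changeMatrix (p J') free i (i + k)| * R ^ k ≤ g k / δ
      rw [hc, abs_div, abs_of_pos (J'.weight_pos _), div_mul_eq_mul_div]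
      exact div_le_div₀ (le_trans (by positivity) h1) h1 hδ (hδ' _)
  have dom : ∀ {ι : Type} (a : ι → ℕ → ℝ) (f : ι → ℕ → ℕ → ℝ) (L : ι → ℕ → ℝ) (G' : ι → ℝ),
      (∀ i, IsPerturbedShift J.perturbation (2 + 2 * |J.α 0|) (f i)) → (∀ i, δ ≤ G' i) →
      (∀ i k, Tendsto (fun n => f i n k) atTop (𝓝 (L i k))) → (∀ i k, a i k = L i k / G' i) →
      GeomDominated a := by
    intro ι a f L G' hfi hG' hL ha R hR0 hR1
    obtain ⟨g, hg, hb⟩ := IsPerturbedShift.exists_summable_bound he0 he hA hR0 hR1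
    refine ⟨fun k => g k / δ, hg.div_const δ, fun i k => ?_⟩
    have h1 : |L i k| * R ^ k ≤ g k := le_of_tendsto ((hL i k).abs.mul_const _)
      (Eventually.of_forall fun n => hb _ (hfi i) n k)
    rw [ha, abs_div, abs_of_pos (hδ.trans_le (hG' i)), div_mul_eq_mul_div]
    exact div_le_div₀ (le_trans (by positivity) h1) h1 hδ (hG' i)
  have hL := hf.tendsto_diagonal he0 he hA
  have hLm := fun m => (hfm m).tendsto_diagonal he0 he hA
  have hδG : δ ≤ G := ge_of_tendsto' hGlim hδle
  refine ⟨_, fun m k => _ / J.weight (m - 1), part J G hf hGlim hδle hδG _ hL,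
    fun m => part _ _ (hfm m) (J.tendsto_weight_truncation m)
      (fun n => by rw [weight_truncation]; exact hδle _) (hδle _) _ (hLm m),
    dom _ (fun _ => _) (fun _ => _) (fun _ => G) (fun _ => hf) (fun _ => hδG) (fun _ => hL)
      fun _ _ => rfl,
    dom _ _ _ _ hfm (fun m => hδle (m - 1)) hLm fun _ _ => rfl, fun k => ?_⟩
  refine (IsPerturbedShift.tendsto_limit he0 he hA hf hfm hL hLm (fun n k => ?_) k).div
    (hGlim.comp (tendsto_sub_atTop_nat 1)) hG.ne'
  -- Row `n` of the array is the same for `J^[m]` and `J` as soon as `m > n`.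
  exact tendsto_const_nhds.congr' (eventually_atTop.mpr ⟨n + 1, fun m hm =>
    (diagArray_truncation hp J (by omega) k).symm⟩)

end JacobiOperator

end

theorem theorem5p10 (J : JacobiOperator) (hJ : J.IsToeplitzPlusTraceClass) :
    ∃ (t tμ : ℕ → ℝ) (tm tmμ : ℕ → ℕ → ℝ),
      -- `t`, `tμ` give the Toeplitz parts of `C` and `C^μ` for `J`
      IsToeplitzPart (J.connection JacobiOperator.free) t ∧
      IsToeplitzPart (J.connectionMu JacobiOperator.free) tμ ∧
      -- `tm m`, `tmμ m` give the Toeplitz parts of `C` and `C^μ` for the truncation `J^[m]`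
      (∀ m, IsToeplitzPart ((J.truncation m).connection JacobiOperator.free) (tm m)) ∧
      (∀ m, IsToeplitzPart ((J.truncation m).connectionMu JacobiOperator.free) (tmμ m)) ∧
      -- the series of all symbols converge in the disc
      SymbolConverges t ∧ SymbolConverges tμ ∧
      (∀ m, SymbolConverges (tm m) ∧ SymbolConverges (tmμ m)) ∧
      -- analyticity
      AnalyticOnNhd ℂ (toeplitzSymbol t) (Metric.ball 0 1) ∧
      AnalyticOnNhd ℂ (toeplitzSymbol tμ) (Metric.ball 0 1) ∧
      -- convergence, uniform on compact subsets of the disc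
      (∀ K : Set ℂ, IsCompact K → K ⊆ Metric.ball 0 1 →
        TendstoUniformlyOn (fun m => toeplitzSymbol (tm m)) (toeplitzSymbol t) atTop K ∧
        TendstoUniformlyOn (fun m => toeplitzSymbol (tmμ m)) (toeplitzSymbol tμ) atTop K) := by
  obtain ⟨t, tm, h, hm, hd, hdm, hlim⟩ :=
    JacobiOperator.exists_toeplitzParts JacobiOperator.isRecurrentFamily_orthoPoly hJ
  obtain ⟨tμ, tmμ, hμ, hmμ, hdμ, hdmμ, hlimμ⟩ :=
    JacobiOperator.exists_toeplitzParts JacobiOperator.isRecurrentFamily_assocPoly hJ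
  exact ⟨t, tμ, tm, tmμ, h, hμ, hm, hmμ, hd.symbolConverges (), hdμ.symbolConverges (),
    fun m => ⟨hdm.symbolConverges m, hdmμ.symbolConverges m⟩,
    hd.analyticOnNhd_toeplitzSymbol (), hdμ.analyticOnNhd_toeplitzSymbol (),
    fun K hK hK1 => ⟨hdm.tendstoUniformlyOn_toeplitzSymbol hlim hK hK1,
      hdmμ.tendstoUniformlyOn_toeplitzSymbol hlimμ hK hK1⟩⟩
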